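/- Let $d\ge 1$ and $\lambda\in(0,\infty)$. Let $\Xi=\sum_{j\in\mathbb Z}\varepsilon_{\xi_j}$ be a homogeneous Poisson process on $\mathbb R^d$ with rate $\lambda$ (where $\varepsilon_x$ is the Dirac measure at $x$), let $\{Y_t,\ t\ge 0\}$ be a random process in $\mathbb R^d$ with $Y_0=0$ almost surely, and let $\{Y^{(j)}_t,\ t\ge 0\}$, $j\in\mathbb Z$, be independent copies of $\{Y_t,\ t\ge 0\}$ such that the family of processes $(Y^{(j)})_{j\in\mathbb Z}$ is independent of the family of initial positions $(\xi_j)_{j\in\mathbb Z}$. The location of the $j$-th particle at time $t$ is $X^{(j)}_t=\xi_j+Y^{(j)}_t$. Let $B\subset\mathbb R^d$ be a compact set with non-empty interior, let $n\ge 1$ and $t_1,\dots,t_n\ge 0$, and let $$N(t_1,\dots,t_n)=\sum_{j\in\mathbb Z}\mathbf 1\{X^{(j)}_{t_1}\in B,\dots,X^{(j)}_{t_n}\in B\}$$ be the number of particles that lie in $B$ at all the times $t_1,\dots,t_n$. Then the function $x\mapsto \mathbb P\{x+Y_{t_1}\in B,\dots,x+Y_{t_n}\in B\}$ is integrable on $\mathbb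 R^d$, $N(t_1,\dots,t_n)$ is almost surely finite and is Poisson distributed with mean $$\lambda\int_{\mathbb R^d}\mathbb P\{x+Y_{t_1}\in B,\dots,x+Y_{t_n}\in B\}\,dx,$$ and, for every $\theta\in\mathbb R$, $\mathbb E\exp\{\theta N(t_1,\dots,t_n)\}<\infty$ and $$\ln\mathbb E\exp\{\theta N(t_1,\dots,t_n)\}=\lambda(e^{\theta}-1)\int_{\mathbb R^d}\mathbb P\{x+Y_{t_1}\in B,\dots,x+Y_{t_n}\in B\}\,dx .$$ -/

import Mathlib

open MeasureTheory ProbabilityTheory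
open scoped NNReal ENNReal

/-- The Poisson law with mean `r`, as the law of a `[0, ∞]`-valued random variable. -/
noncomputable def poissonLaw (r : ℝ≥0) : Measure ℝ≥0∞ :=
  (poissonMeasure r).map (fun k : ℕ => (k : ℝ≥0∞))

/-- The point process `∑ j, ε_{ξ j}`, as a random measure on `ℝ^d`. -/
noncomputable def pointProcess {Ω : Type*} {d : ℕ} (ξ : ℤ → Ω → EuclideanSpace ℝ (Fin d)) (ω : Ω) :
    Measure (EuclideanSpace ℝ (Fin d)) :=
  Measure.sum fun j => Measure.dirac (ξ j ω)

/-- A random measure `Ξ` on `ℝ^d` is a homogeneous Poisson process with rate `lam`: the number of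
points in a Borel set `A` of finite volume is Poisson with mean `lam * vol A`, and the numbers of
points in finitely many pairwise disjoint Borel sets are independent. -/
structure IsHomogeneousPoissonProcess {Ω : Type*} [MeasurableSpace Ω] {d : ℕ}
    (Ξ : Ω → Measure (EuclideanSpace ℝ (Fin d))) (lam : ℝ≥0) (μ : Measure Ω) : Prop where
  poisson : ∀ A : Set (EuclideanSpace ℝ (Fin d)), MeasurableSet A → volume A ≠ ∞ →
    HasLaw (fun ω => Ξ ω A) (poissonLaw (lam * (volume A).toNNReal)) μ
  indep : ∀ (m : ℕ) (A : Fin m → Set (EuclideanSpace ℝ (Fin d))), (∀ i, MeasurableSet (A i)) →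
    Pairwise (fun i k => Disjoint (A i) (A k)) → iIndepFun (fun i ω => Ξ ω (A i)) μ

/-- A displacement process: a stochastic process in `ℝ^d` indexed by `t ≥ 0` and started at `0`. -/
structure IsDisplacementProcess {Ω : Type*} [MeasurableSpace Ω] {d : ℕ}
    (Y : ℝ≥0 → Ω → EuclideanSpace ℝ (Fin d)) (P : Measure Ω) : Prop where
  measurable : ∀ t, Measurable (Y t)
  zero : ∀ᵐ ω ∂P, Y 0 ω = 0

/-- The particle model. The initial positions `ξ j` form a homogeneous Poisson process with rate
`lam`; the displacements `Z j` are independent copies of the process `Y` (with the same law on path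
space, i.e. the same finite-dimensional distributions); and the positions are independent of the
displacements. -/
structure IsParticleModel {Ω Ω' : Type*} [MeasurableSpace Ω] [MeasurableSpace Ω'] {d : ℕ}
    (ξ : ℤ → Ω → EuclideanSpace ℝ (Fin d)) (Z : ℤ → ℝ≥0 → Ω → EuclideanSpace ℝ (Fin d))
    (μ : Measure Ω) (Y : ℝ≥0 → Ω' → EuclideanSpace ℝ (Fin d)) (P : Measure Ω') (lam : ℝ≥0) :
    Prop where
  measurable_position : ∀ j, Measurable (ξ j)
  poisson : IsHomogeneousPoissonProcess (pointProcess ξ) lam μ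
  displacement : IsDisplacementProcess Y P
  copies : ∀ j, IdentDistrib (fun ω t => Z j t ω) (fun ω' t => Y t ω') μ P
  measurable_displacement : ∀ j t, Measurable (Z j t)
  indep_displacements : iIndepFun (fun j ω t => Z j t ω) μ
  indep : IndepFun (fun ω j => ξ j ω) (fun ω j t => Z j t ω) μ

/-- The location `X_t^{(j)} = ξ_j + Z_t^{(j)}` of the `j`-th particle at time `t`. -/
noncomputable def particleLocation {Ω : Type*} {d : ℕ} (ξ : ℤ → Ω → EuclideanSpace ℝ (Fin d))
    (Z : ℤ → ℝ≥0 → Ω → EuclideanSpace ℝ (Fin d)) (j : ℤ) (t : ℝ≥0) (ω : Ω) :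
    EuclideanSpace ℝ (Fin d) :=
  ξ j ω + Z j t ω

open Classical in
/-- `N(t_1, …, t_n)`: the number, in `[0, ∞]`, of particles that lie in `B` at all the times
`t_1, …, t_n`. -/
noncomputable def jointCount {Ω : Type*} {d : ℕ} (ξ : ℤ → Ω → EuclideanSpace ℝ (Fin d))
    (Z : ℤ → ℝ≥0 → Ω → EuclideanSpace ℝ (Fin d)) (B : Set (EuclideanSpace ℝ (Fin d)))
    {n : ℕ} (t : Fin n → ℝ≥0) (ω : Ω) : ℝ≥0∞ :=
  ∑' j : ℤ, if ∀ k, particleLocation ξ Z j (t k) ω ∈ B then 1 else 0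

/-!
The particles form a Poisson process whose points are marked by independent displacement paths, and
`N(t_1, …, t_n)` counts the marked points in the set `S` of all pairs `(x, y)` of a starting point
and a path such that `x + y (t_k) ∈ B` for every `k`. Conditionally on the points, the marks are
independent, so averaging over them turns `E exp (-∑ j, u (ξ j, W j))` into the Laplace functional
of the unmarked process at the deterministic function `x ↦ -log E exp (-u (x, Y))`. The Laplace
functional of a Poisson process, first obtained for simple functions from the independence of the
counts on level sets and then by monotone approximation, gives
`exp (-λ ∫ E (1 - exp (-u (x, Y))) dx)`. For `u = c 1_S` this is the Laplace transform of the
Poisson law with mean `λ (dx ⊗ ν) S`, where `ν` is the law of a path, and Laplace transforms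
determine laws on `[0, ∞]`. The mean is finite because `(dx ⊗ ν) S ≤ vol B` by translation
invariance.
-/

open Filter Topology
open scoped BoundedContinuousFunction

section LaplaceTransform

/-- The function `x ↦ e^{-x}` on `[0, ∞]`, with `e^{-∞} = 0`: the kernel of the Laplace transforms
of `[0, ∞]`-valued random variables. -/
noncomputable def expNeg (x : ℝ≥0∞) : ℝ≥0∞ := EReal.exp (-(x : EReal))

@[simp] lemma expNeg_zero : expNeg 0 = 1 := by simp [expNeg]

lemma expNeg_add (x y : ℝ≥0∞) : expNeg (x + y) = expNeg x * expNeg y := by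
  rw [expNeg, EReal.coe_ennreal_add, EReal.neg_add (.inl (EReal.coe_ennreal_ne_bot x))
    (.inr (EReal.coe_ennreal_ne_bot y)), sub_eq_add_neg, EReal.exp_add]
  rfl

lemma expNeg_sum {ι : Type*} (s : Finset ι) (f : ι → ℝ≥0∞) :
    expNeg (∑ i ∈ s, f i) = ∏ i ∈ s, expNeg (f i) := by
  induction s using Finset.cons_induction with
  | empty => simp
  | cons a s ha ih => rw [Finset.sum_cons, Finset.prod_cons, expNeg_add, ih]

lemma expNeg_natCast_mul (n : ℕ) (x : ℝ≥0∞) : expNeg (n * x) = expNeg x ^ n := by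
  simpa using expNeg_sum (Finset.range n) fun _ => x

lemma antitone_expNeg : Antitone expNeg := fun _ _ h =>
  EReal.exp_monotone (EReal.neg_le_neg_iff.2 (EReal.coe_ennreal_le_coe_ennreal_iff.2 h))

lemma expNeg_le_one (x : ℝ≥0∞) : expNeg x ≤ 1 :=
  expNeg_zero ▸ antitone_expNeg zero_le

lemma expNeg_ne_top (x : ℝ≥0∞) : expNeg x ≠ ∞ :=
  ((expNeg_le_one x).trans_lt ENNReal.one_lt_top).ne

lemma expNeg_toReal_le_one (x : ℝ≥0∞) : (expNeg x).toReal ≤ 1 :=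
  ENNReal.toReal_mono ENNReal.one_ne_top (expNeg_le_one x)

lemma injective_expNeg : Function.Injective expNeg :=
  EReal.exp_strictMono.injective.comp (neg_injective.comp EReal.coe_ennreal_injective)

@[fun_prop]
lemma continuous_expNeg : Continuous expNeg :=
  ENNReal.continuous_exp.comp (continuous_neg.comp continuous_coe_ennreal_ereal)

@[fun_prop]
lemma measurable_expNeg : Measurable expNeg := continuous_expNeg.measurable

lemma expNeg_ofReal {x : ℝ} (hx : 0 ≤ x) :
    expNeg (ENNReal.ofReal x) = ENNReal.ofReal (Real.exp (-x)) := by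
  rw [expNeg, EReal.coe_ennreal_ofReal, max_eq_left hx, ← EReal.coe_neg, EReal.exp_coe]

/-- The function `x ↦ -log x` on `[0, 1]`, extended by `0` to `(1, ∞]`: the inverse of `expNeg`. -/
noncomputable def negLog (x : ℝ≥0∞) : ℝ≥0∞ := (-ENNReal.log x).toENNReal

@[fun_prop]
lemma measurable_negLog : Measurable negLog :=
  (continuous_neg.comp ENNReal.continuous_log).ereal_toENNReal.measurable

lemma expNeg_negLog {x : ℝ≥0∞} (hx : x ≤ 1) : expNeg (negLog x) = x := by
  have hlog : 0 ≤ -ENNReal.log x := by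
    simpa only [EReal.neg_nonneg, ENNReal.log_one] using ENNReal.log_monotone hx
  rw [expNeg, negLog, EReal.coe_toENNReal hlog, neg_neg, ENNReal.exp_log]

theorem measure_ext_of_integral_pow {E : Type*} [TopologicalSpace E] [PolishSpace E]
    [MeasurableSpace E] [BorelSpace E] {μ ν : Measure E} [IsFiniteMeasure μ] [IsFiniteMeasure ν]
    {f : E →ᵇ ℝ} (hf : Function.Injective f)
    (h : ∀ n : ℕ, ∫ x, f x ^ n ∂μ = ∫ x, f x ^ n ∂ν) : μ = ν := by
  -- The polynomials in `f` form an algebra that separates points.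
  let A : StarSubalgebra ℝ (E →ᵇ ℝ) :=
    { toSubalgebra := (Polynomial.aeval (R := ℝ) f).range
      star_mem' := fun {a} ha => by rwa [show star a = a by ext x; simp] }
  refine ext_of_forall_mem_subalgebra_integral_eq_of_polish (𝕜 := ℝ) (A := A) ?_ ?_
  · exact fun x y hxy => ⟨_, ⟨_, ⟨f, ⟨Polynomial.X, by simp⟩, rfl⟩, rfl⟩, hf.ne hxy⟩
  · rintro _ ⟨p, rfl⟩
    have integral_aeval (ρ : Measure E) [IsFiniteMeasure ρ] :
        ∫ x, Polynomial.aeval f p x ∂ρ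
          = ∑ i ∈ Finset.range (p.natDegree + 1), p.coeff i * ∫ x, f x ^ i ∂ρ := by
      simp only [Polynomial.aeval_eq_sum_range, BoundedContinuousFunction.sum_apply,
        BoundedContinuousFunction.smul_apply, BoundedContinuousFunction.pow_apply, smul_eq_mul]
      have hint (i : ℕ) : Integrable (fun x => f x ^ i) ρ := (f ^ i).integrable ρ
      rw [integral_finsetSum _ fun i _ => (hint i).const_mul (p.coeff i)]
      simp only [integral_const_mul]
    refine (integral_aeval μ).trans (.trans ?_ (integral_aeval ν).symm)
    simp only [h]

theorem measure_ext_of_lintegral_expNeg {μ ν : Measure ℝ≥0∞} [IsFiniteMeasure μ]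
    [IsFiniteMeasure ν] (h : ∀ n : ℕ, ∫⁻ x, expNeg (n * x) ∂μ = ∫⁻ x, expNeg (n * x) ∂ν) :
    μ = ν := by
  have hcont : Continuous fun x => (expNeg x).toReal :=
    ENNReal.continuousOn_toReal.comp_continuous continuous_expNeg expNeg_ne_top
  let f : ℝ≥0∞ →ᵇ ℝ := .ofNormedAddCommGroup _ hcont 1 fun x => by
    simpa using expNeg_toReal_le_one x
  have integral_pow (ρ : Measure ℝ≥0∞) (n : ℕ) :
      ∫ x, f x ^ n ∂ρ = (∫⁻ x, expNeg (n * x) ∂ρ).toReal := by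
    rw [← integral_toReal (by fun_prop) (ae_of_all _ fun x => (expNeg_ne_top _).lt_top)]
    simp [f, expNeg_natCast_mul]
  refine measure_ext_of_integral_pow (f := f) (fun x y hxy => injective_expNeg ?_) fun n => ?_
  · exact (ENNReal.toReal_eq_toReal_iff' (expNeg_ne_top x) (expNeg_ne_top y)).1 hxy
  · rw [integral_pow, integral_pow, h]

theorem lintegral_expNeg_tsum_of_iIndepFun {Ω ι : Type*} [MeasurableSpace Ω] [Countable ι]
    {μ : Measure Ω} {V : ι → Ω → ℝ≥0∞} (hV : ∀ j, Measurable (V j)) (hind : iIndepFun V μ) :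
    ∫⁻ ω, expNeg (∑' j, V j ω) ∂μ = expNeg (∑' j, negLog (∫⁻ ω, expNeg (V j ω) ∂μ)) := by
  have := hind.isProbabilityMeasure
  have finite_sum (F : Finset ι) : ∫⁻ ω, expNeg (∑ j ∈ F, V j ω) ∂μ
      = expNeg (∑ j ∈ F, negLog (∫⁻ ω, expNeg (V j ω) ∂μ)) := by
    have hle (j : ι) : ∫⁻ ω, expNeg (V j ω) ∂μ ≤ 1 :=
      (lintegral_mono fun ω => expNeg_le_one (V j ω)).trans (by simp)
    simp only [expNeg_sum, expNeg_negLog (hle _)]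
    exact lintegral_prod_eq_prod_lintegral_of_indepFun F _
      (hind.comp _ fun _ => measurable_expNeg) fun j => measurable_expNeg.comp (hV j)
  have tendsto_left : Tendsto (fun F : Finset ι => ∫⁻ ω, expNeg (∑ j ∈ F, V j ω) ∂μ) atTop
      (𝓝 (∫⁻ ω, expNeg (∑' j, V j ω) ∂μ)) :=
    tendsto_lintegral_filter_of_dominated_convergence (fun _ => 1)
      (.of_forall fun F => by fun_prop) (.of_forall fun F => ae_of_all _ fun ω => expNeg_le_one _)
      (by simp) (ae_of_all _ fun ω => (continuous_expNeg.tendsto _).comp ENNReal.summable.hasSum)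
  refine tendsto_nhds_unique tendsto_left ?_
  simp only [finite_sum]
  exact (continuous_expNeg.tendsto _).comp ENNReal.summable.hasSum

end LaplaceTransform

section PoissonLaw

lemma hasSum_pow_poissonMeasure (r : ℝ≥0) (q : ℝ) :
    HasSum (fun k : ℕ => Real.exp (-r) * r ^ k / k.factorial * q ^ k)
      (Real.exp (r * (q - 1))) := by
  have h := (NormedSpace.expSeries_div_hasSum_exp (r * q : ℝ)).mul_left (Real.exp (-r))
  rw [← Real.exp_eq_exp_ℝ, ← Real.exp_add] at h
  convert! h using 2
  · ring
  · ring

lemma integrable_pow_poissonMeasure (r : ℝ≥0) (q : ℝ) :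
    Integrable (fun k : ℕ => q ^ k) (poissonMeasure r) := by
  simpa [integrable_poissonMeasure_iff] using (hasSum_pow_poissonMeasure r |q|).summable

lemma integral_pow_poissonMeasure (r : ℝ≥0) (q : ℝ) :
    ∫ k : ℕ, q ^ k ∂(poissonMeasure r) = Real.exp (r * (q - 1)) :=
  (hasSum_integral_poissonMeasure (integrable_pow_poissonMeasure r q)).unique
    (hasSum_pow_poissonMeasure r q)

instance isProbabilityMeasure_poissonLaw (r : ℝ≥0) : IsProbabilityMeasure (poissonLaw r) :=
  Measure.isProbabilityMeasure_map .of_discrete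

lemma lintegral_expNeg_poissonLaw (r : ℝ≥0) (c : ℝ≥0∞) :
    ∫⁻ x, expNeg (c * x) ∂(poissonLaw r) = expNeg (r * (1 - expNeg c)) := by
  set q : ℝ := (expNeg c).toReal
  have hq : expNeg c = ENNReal.ofReal q := (ENNReal.ofReal_toReal (expNeg_ne_top c)).symm
  have hq0 : 0 ≤ q := ENNReal.toReal_nonneg
  have hq1 : 0 ≤ r * (1 - q) := mul_nonneg r.coe_nonneg (sub_nonneg.2 (expNeg_toReal_le_one c))
  calc ∫⁻ x, expNeg (c * x) ∂(poissonLaw r)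
      = ∫⁻ k : ℕ, ENNReal.ofReal (q ^ k) ∂(poissonMeasure r) := by
        rw [poissonLaw, lintegral_map (by fun_prop) .of_discrete]
        simp only [mul_comm c, expNeg_natCast_mul, hq, ENNReal.ofReal_pow hq0]
    _ = ENNReal.ofReal (Real.exp (r * (q - 1))) := by
        rw [← ofReal_integral_eq_lintegral_ofReal (integrable_pow_poissonMeasure r q)
          (ae_of_all _ fun k => pow_nonneg hq0 k), integral_pow_poissonMeasure]
    _ = expNeg (ENNReal.ofReal (r * (1 - q))) := by
        rw [expNeg_ofReal hq1, ← mul_neg, neg_sub]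
    _ = expNeg (r * (1 - expNeg c)) := by
        rw [hq, ENNReal.ofReal_mul r.coe_nonneg, ENNReal.ofReal_sub _ hq0, ENNReal.ofReal_one,
          ENNReal.ofReal_coe_nnreal]

variable {Ω : Type*} [MeasurableSpace Ω] {μ : Measure Ω} {N : Ω → ℝ≥0∞} {r : ℝ≥0}

lemma ae_ne_top_of_hasLaw_poissonLaw (hN : HasLaw N (poissonLaw r) μ) : ∀ᵐ ω ∂μ, N ω ≠ ∞ := by
  have hne : MeasurableSet {x : ℝ≥0∞ | x ≠ ∞} := (measurableSet_singleton _).compl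
  rw [hN.ae_iff (measurableSet_setOfPred.1 hne), poissonLaw,
    ae_map_iff Measurable.of_discrete.aemeasurable hne]
  exact ae_of_all _ ENNReal.natCast_ne_top

lemma integrable_exp_mul_of_hasLaw_poissonLaw (hN : HasLaw N (poissonLaw r) μ) (θ : ℝ) :
    Integrable (fun ω => Real.exp (θ * (N ω).toReal)) μ := by
  have h : Integrable (fun x : ℝ≥0∞ => Real.exp (θ * x.toReal)) (μ.map N) := by
    rw [hN.map_eq, poissonLaw, integrable_map_measure (by fun_prop) .of_discrete]
    simpa [Function.comp_def, mul_comm θ, Real.exp_nat_mul] using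
      integrable_pow_poissonMeasure r (Real.exp θ)
  exact h.comp_aemeasurable hN.aemeasurable

lemma cgf_toReal_of_hasLaw_poissonLaw (hN : HasLaw N (poissonLaw r) μ) (θ : ℝ) :
    cgf (fun ω => (N ω).toReal) μ θ = r * (Real.exp θ - 1) := by
  have h : ∫ ω, Real.exp (θ * (N ω).toReal) ∂μ = Real.exp (r * (Real.exp θ - 1)) := by
    refine (hN.integral_comp (f := fun x => Real.exp (θ * x.toReal)) (by fun_prop)).trans ?_
    rw [poissonLaw, integral_map .of_discrete (by fun_prop), ← integral_pow_poissonMeasure]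
    simp [mul_comm θ, Real.exp_nat_mul]
  rw [cgf, mgf, h, Real.log_exp]

end PoissonLaw

theorem exists_monotone_finMeasSupp_tendsto {α : Type*} [MeasurableSpace α] (m : Measure α)
    [SigmaFinite m] {f : α → ℝ≥0∞} (hf : Measurable f) :
    ∃ g : ℕ → SimpleFunc α ℝ≥0∞, (∀ n, (g n).FinMeasSupp m) ∧ (∀ x, Monotone fun n => g n x) ∧
      ∀ x, Tendsto (fun n => g n x) atTop (𝓝 (f x)) := by
  have hK := measurableSet_spanningSets m
  let g (n : ℕ) := (SimpleFunc.eapprox f n).restrict (spanningSets m n)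
  have g_apply (n : ℕ) (x : α) :
      g n x = (spanningSets m n).indicator (SimpleFunc.eapprox f n) x :=
    SimpleFunc.restrict_apply _ (hK n) x
  refine ⟨g, fun n => ?_, fun x k n hkn => ?_, fun x => ?_⟩
  · refine SimpleFunc.finMeasSupp_iff.2 fun y hy => ?_
    rw [SimpleFunc.restrict_preimage_singleton _ (hK n) hy]
    exact (measure_mono Set.inter_subset_left).trans_lt (measure_spanningSets_lt_top m n)
  · simp only [g_apply]
    exact (Set.indicator_le_indicator (SimpleFunc.monotone_eapprox f hkn x)).trans
      (Set.indicator_le_indicator_of_subset (monotone_spanningSets m hkn) (fun _ => zero_le) x)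
  · refine (SimpleFunc.tendsto_eapprox hf x).congr' ?_
    filter_upwards [eventually_mem_spanningSets m x] with n hn
    rw [g_apply, Set.indicator_of_mem hn]

section LaplaceFunctional

namespace IsHomogeneousPoissonProcess

variable {Ω : Type*} [MeasurableSpace Ω] {d : ℕ} {μ : Measure Ω} {lam : ℝ≥0}
  {Ξ : Ω → Measure (EuclideanSpace ℝ (Fin d))}

lemma isProbabilityMeasure (h : IsHomogeneousPoissonProcess Ξ lam μ) : IsProbabilityMeasure μ :=
  (h.poisson ∅ .empty (by simp)).isProbabilityMeasure

lemma iIndepFun_apply {ι : Type*} [Finite ι] (h : IsHomogeneousPoissonProcess Ξ lam μ)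
    {A : ι → Set (EuclideanSpace ℝ (Fin d))} (hA : ∀ i, MeasurableSet (A i))
    (hdisj : Pairwise (Function.onFun Disjoint A)) : iIndepFun (fun i ω => Ξ ω (A i)) μ := by
  let e := Finite.equivFin ι
  have hfin := h.indep _ (fun i => A (e.symm i)) (fun i => hA _)
    fun i k hik => hdisj (e.symm.injective.ne hik)
  simpa [Function.comp_def] using hfin.precomp e.injective

/-- For `c = 0` infinite volume is allowed: this covers the zero level set of a simple function. -/
lemma lintegral_expNeg_mul_apply (h : IsHomogeneousPoissonProcess Ξ lam μ) (c : ℝ≥0∞)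
    {A : Set (EuclideanSpace ℝ (Fin d))} (hA : MeasurableSet A) (hAc : c ≠ 0 → volume A ≠ ∞) :
    ∫⁻ ω, expNeg (c * Ξ ω A) ∂μ = expNeg (lam * ((1 - expNeg c) * volume A)) := by
  have := h.isProbabilityMeasure
  rcases eq_or_ne c 0 with rfl | hc
  · simp
  · rw [(h.poisson A hA (hAc hc)).lintegral_comp (f := fun x => expNeg (c * x)) (by fun_prop),
      lintegral_expNeg_poissonLaw, ENNReal.coe_mul, ENNReal.coe_toNNReal (hAc hc),
      mul_right_comm, mul_assoc]

lemma lintegral_expNeg_simpleFunc (h : IsHomogeneousPoissonProcess Ξ lam μ) (hΞ : Measurable Ξ)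
    {g : SimpleFunc (EuclideanSpace ℝ (Fin d)) ℝ≥0∞} (hg : g.FinMeasSupp volume) :
    ∫⁻ ω, expNeg (∫⁻ x, g x ∂(Ξ ω)) ∂μ = expNeg (lam * ∫⁻ x, (1 - expNeg (g x))) := by
  let A (y : g.range) : Set (EuclideanSpace ℝ (Fin d)) := g ⁻¹' {(y : ℝ≥0∞)}
  have hA (y : g.range) : MeasurableSet (A y) := g.measurableSet_fiber y
  have hcount : iIndepFun (fun y ω => Ξ ω (A y)) μ :=
    h.iIndepFun_apply hA fun y z hyz =>
      (Set.disjoint_singleton.2 (Subtype.coe_injective.ne hyz)).preimage g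
  have lintegral_comp (φ : ℝ≥0∞ → ℝ≥0∞) (m : Measure (EuclideanSpace ℝ (Fin d))) :
      ∫⁻ x, φ (g x) ∂m = ∑ y : g.range, φ y * m (A y) := by
    rw [Finset.sum_coe_sort g.range fun y => φ y * m (g ⁻¹' {y}), ← SimpleFunc.map_lintegral,
      ← SimpleFunc.lintegral_eq_lintegral]
    rfl
  calc ∫⁻ ω, expNeg (∫⁻ x, g x ∂(Ξ ω)) ∂μ
      = ∫⁻ ω, ∏ y : g.range, expNeg (y * Ξ ω (A y)) ∂μ := by
        simp only [← expNeg_sum]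
        exact lintegral_congr fun ω => congrArg expNeg (lintegral_comp id (Ξ ω))
    _ = ∏ y : g.range, ∫⁻ ω, expNeg (y * Ξ ω (A y)) ∂μ :=
        lintegral_prod_eq_prod_lintegral_of_indepFun Finset.univ _
          (hcount.comp (fun y x => expNeg (y * x)) fun y => by fun_prop)
          fun y => (measurable_expNeg.comp (measurable_const_mul _)).comp
            ((Measure.measurable_coe (hA y)).comp hΞ)
    _ = ∏ y : g.range, expNeg (lam * ((1 - expNeg y) * volume (A y))) :=
        Finset.prod_congr rfl fun y _ => h.lintegral_expNeg_mul_apply y (hA y)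
          fun hy => (hg.meas_preimage_singleton_ne_zero hy).ne
    _ = expNeg (lam * ∫⁻ x, (1 - expNeg (g x))) := by
        rw [← expNeg_sum, ← Finset.mul_sum, lintegral_comp fun y => 1 - expNeg y]

theorem lintegral_expNeg (h : IsHomogeneousPoissonProcess Ξ lam μ) (hΞ : Measurable Ξ)
    {f : EuclideanSpace ℝ (Fin d) → ℝ≥0∞} (hf : Measurable f) :
    ∫⁻ ω, expNeg (∫⁻ x, f x ∂(Ξ ω)) ∂μ = expNeg (lam * ∫⁻ x, (1 - expNeg (f x))) := by
  have := h.isProbabilityMeasure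
  obtain ⟨g, hg, hmono, hlim⟩ := exists_monotone_finMeasSupp_tendsto volume hf
  have tendsto_left : Tendsto (fun n => ∫⁻ ω, expNeg (∫⁻ x, g n x ∂(Ξ ω)) ∂μ) atTop
      (𝓝 (∫⁻ ω, expNeg (∫⁻ x, f x ∂(Ξ ω)) ∂μ)) := by
    refine tendsto_lintegral_of_dominated_convergence (fun _ => 1)
      (fun n => measurable_expNeg.comp ((Measure.measurable_lintegral (g n).measurable).comp hΞ))
      (fun n => ae_of_all _ fun ω => expNeg_le_one _) (by simp) (ae_of_all _ fun ω => ?_)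
    exact (continuous_expNeg.tendsto _).comp (lintegral_tendsto_of_tendsto_of_monotone
      (fun n => (g n).measurable.aemeasurable) (ae_of_all _ hmono) (ae_of_all _ hlim))
  have tendsto_right : Tendsto (fun n => expNeg (lam * ∫⁻ x, (1 - expNeg (g n x)))) atTop
      (𝓝 (expNeg (lam * ∫⁻ x, (1 - expNeg (f x))))) := by
    refine (continuous_expNeg.tendsto _).comp
      (ENNReal.Tendsto.const_mul ?_ (.inr ENNReal.coe_ne_top))
    refine lintegral_tendsto_of_tendsto_of_monotone (fun n => by fun_prop)
      (ae_of_all _ fun x k n hkn => tsub_le_tsub_left (antitone_expNeg (hmono x hkn)) 1)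
      (ae_of_all _ fun x => ?_)
    exact ENNReal.Tendsto.sub tendsto_const_nhds ((continuous_expNeg.tendsto _).comp (hlim x))
      (.inl ENNReal.one_ne_top)
  refine tendsto_nhds_unique tendsto_left (tendsto_right.congr fun n => ?_)
  exact (h.lintegral_expNeg_simpleFunc hΞ (hg n)).symm

end IsHomogeneousPoissonProcess

end LaplaceFunctional

section Marking

/-- The random marks `W j` of the random points `ξ j` are independent of each other and of the
points, and have common law `ν`: an independent marking, as in the marking theorem for Poisson
processes. -/
structure IsIndependentMarking {Ω ι α β : Type*} [MeasurableSpace Ω] [MeasurableSpace α]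
    [MeasurableSpace β] (ξ : ι → Ω → α) (W : ι → Ω → β) (ν : Measure β) (μ : Measure Ω) :
    Prop where
  measurable_point : ∀ j, Measurable (ξ j)
  measurable_mark : ∀ j, Measurable (W j)
  map_mark : ∀ j, μ.map (W j) = ν
  iIndepFun_mark : iIndepFun W μ
  indepFun : IndepFun (fun ω j => ξ j ω) (fun ω j => W j ω) μ

theorem IsIndependentMarking.lintegral_expNeg_tsum {Ω ι α β : Type*} [MeasurableSpace Ω]
    [MeasurableSpace α] [MeasurableSpace β] [Countable ι] {μ : Measure Ω} {ξ : ι → Ω → α}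
    {W : ι → Ω → β} {ν : Measure β} (h : IsIndependentMarking ξ W ν μ) {u : α × β → ℝ≥0∞}
    (hu : Measurable u) :
    ∫⁻ ω, expNeg (∑' j, u (ξ j ω, W j ω)) ∂μ
      = ∫⁻ ω, expNeg (∑' j, negLog (∫⁻ w, expNeg (u (ξ j ω, w)) ∂ν)) ∂μ := by
  have := h.iIndepFun_mark.isProbabilityMeasure
  have hξ : Measurable fun ω j => ξ j ω := measurable_pi_lambda _ h.measurable_point
  have hW : Measurable fun ω j => W j ω := measurable_pi_lambda _ h.measurable_mark
  have hux (x : α) : Measurable fun w => u (x, w) := hu.comp measurable_prodMk_left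
  have hG : Measurable fun z : (ι → α) × (ι → β) => expNeg (∑' j, u (z.1 j, z.2 j)) := by fun_prop
  have hjoint :=
    (indepFun_iff_map_prod_eq_prod_map_map hξ.aemeasurable hW.aemeasurable).1 h.indepFun
  calc ∫⁻ ω, expNeg (∑' j, u (ξ j ω, W j ω)) ∂μ
      = ∫⁻ z, expNeg (∑' j, u (z.1 j, z.2 j))
          ∂(μ.map fun ω => (fun j => ξ j ω, fun j => W j ω)) :=
        (lintegral_map hG (hξ.prodMk hW)).symm
    _ = ∫⁻ ω, ∫⁻ ω', expNeg (∑' j, u (ξ j ω, W j ω')) ∂μ ∂μ := by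
        rw [hjoint, lintegral_prod _ hG.aemeasurable, lintegral_map hG.lintegral_prod_right' hξ]
        exact lintegral_congr fun ω => lintegral_map (hG.comp measurable_prodMk_left) hW
    _ = ∫⁻ ω, expNeg (∑' j, negLog (∫⁻ w, expNeg (u (ξ j ω, w)) ∂ν)) ∂μ := by
        refine lintegral_congr fun ω => ?_
        have hmark (j : ι) (x : α) :
            ∫⁻ w, expNeg (u (x, w)) ∂ν = ∫⁻ ω', expNeg (u (x, W j ω')) ∂μ := by
          rw [← h.map_mark j]
          exact lintegral_map (measurable_expNeg.comp (hux x)) (h.measurable_mark j)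
        simp only [fun j => hmark j (ξ j ω)]
        exact lintegral_expNeg_tsum_of_iIndepFun (fun j => (hux _).comp (h.measurable_mark j))
          (h.iIndepFun_mark.comp _ fun j => hux (ξ j ω))

section PointProcess

lemma lintegral_pointProcess {Ω : Type*} {d : ℕ} (ξ : ℤ → Ω → EuclideanSpace ℝ (Fin d))
    (ω : Ω) (f : EuclideanSpace ℝ (Fin d) → ℝ≥0∞) :
    ∫⁻ x, f x ∂(pointProcess ξ ω) = ∑' j, f (ξ j ω) := by
  simp [pointProcess, lintegral_sum_measure]

variable {Ω β : Type*} [MeasurableSpace Ω] [MeasurableSpace β] {d : ℕ} {μ : Measure Ω} {lam : ℝ≥0}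
  {ξ : ℤ → Ω → EuclideanSpace ℝ (Fin d)} {W : ℤ → Ω → β} {ν : Measure β}

lemma measurable_pointProcess (hξ : ∀ j, Measurable (ξ j)) : Measurable (pointProcess ξ) :=
  Measure.measurable_of_measurable_coe _ fun s hs => by
    simp only [pointProcess, Measure.sum_apply _ hs]
    exact .tsum fun j => (Measure.measurable_coe hs).comp (Measure.measurable_dirac.comp (hξ j))

theorem IsHomogeneousPoissonProcess.lintegral_expNeg_tsum_marked
    (h : IsHomogeneousPoissonProcess (pointProcess ξ) lam μ) (hW : IsIndependentMarking ξ W ν μ)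
    {u : EuclideanSpace ℝ (Fin d) × β → ℝ≥0∞} (hu : Measurable u) :
    ∫⁻ ω, expNeg (∑' j, u (ξ j ω, W j ω)) ∂μ
      = expNeg (lam * ∫⁻ z, (1 - expNeg (u z)) ∂(volume.prod ν)) := by
  have := h.isProbabilityMeasure
  have : IsProbabilityMeasure ν :=
    hW.map_mark 0 ▸ Measure.isProbabilityMeasure_map (hW.measurable_mark 0).aemeasurable
  let H (x : EuclideanSpace ℝ (Fin d)) : ℝ≥0∞ := ∫⁻ w, expNeg (u (x, w)) ∂ν
  have hH : Measurable H := (measurable_expNeg.comp hu).lintegral_prod_right'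
  have hH1 (x) : H x ≤ 1 := (lintegral_mono fun w => expNeg_le_one (u (x, w))).trans (by simp)
  have one_sub_H (x) : 1 - H x = ∫⁻ w, (1 - expNeg (u (x, w))) ∂ν := by
    rw [lintegral_sub (by fun_prop) ((hH1 x).trans_lt ENNReal.one_lt_top).ne
      (ae_of_all _ fun w => expNeg_le_one _), lintegral_one, measure_univ]
  calc ∫⁻ ω, expNeg (∑' j, u (ξ j ω, W j ω)) ∂μ
      = ∫⁻ ω, expNeg (∫⁻ x, negLog (H x) ∂(pointProcess ξ ω)) ∂μ := by
        simp only [hW.lintegral_expNeg_tsum hu, lintegral_pointProcess, H]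
    _ = expNeg (lam * ∫⁻ x, (1 - H x)) := by
        rw [h.lintegral_expNeg (measurable_pointProcess hW.measurable_point) (by fun_prop)]
        simp only [expNeg_negLog (hH1 _)]
    _ = expNeg (lam * ∫⁻ z, (1 - expNeg (u z)) ∂(volume.prod ν)) := by
        rw [lintegral_prod _ (by fun_prop)]
        simp only [one_sub_H]

theorem IsHomogeneousPoissonProcess.hasLaw_tsum_indicator_marked
    (h : IsHomogeneousPoissonProcess (pointProcess ξ) lam μ) (hW : IsIndependentMarking ξ W ν μ)
    {S : Set (EuclideanSpace ℝ (Fin d) × β)} (hS : MeasurableSet S)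
    (hS' : volume.prod ν S ≠ ∞) :
    HasLaw (fun ω => ∑' j, (S.indicator 1 (ξ j ω, W j ω) : ℝ≥0∞))
      (poissonLaw (lam * (volume.prod ν S).toNNReal)) μ := by
  have := h.isProbabilityMeasure
  have hind : Measurable fun z => (S.indicator 1 z : ℝ≥0∞) := measurable_one.indicator hS
  have hN : Measurable fun ω => ∑' j, (S.indicator 1 (ξ j ω, W j ω) : ℝ≥0∞) :=
    .tsum fun j => hind.comp ((hW.measurable_point j).prodMk (hW.measurable_mark j))
  have := Measure.isProbabilityMeasure_map (μ := μ) hN.aemeasurable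
  refine ⟨hN.aemeasurable, measure_ext_of_lintegral_expNeg fun n => ?_⟩
  have one_sub_expNeg (z) :
      1 - expNeg (n * S.indicator 1 z) = S.indicator (fun _ => 1 - expNeg n) z := by
    by_cases hz : z ∈ S <;> simp [hz]
  rw [lintegral_map (by fun_prop) hN]
  calc ∫⁻ ω, expNeg (n * ∑' j, S.indicator 1 (ξ j ω, W j ω)) ∂μ
      = expNeg (lam * ∫⁻ z, (1 - expNeg (n * S.indicator 1 z)) ∂(volume.prod ν)) := by
        simp only [← ENNReal.tsum_mul_left]
        exact h.lintegral_expNeg_tsum_marked hW (hind.const_mul (n : ℝ≥0∞))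
    _ = expNeg (lam * ((1 - expNeg n) * volume.prod ν S)) := by
        simp only [one_sub_expNeg, lintegral_indicator_const hS]
    _ = ∫⁻ x, expNeg (n * x) ∂(poissonLaw (lam * (volume.prod ν S).toNNReal)) := by
        rw [lintegral_expNeg_poissonLaw, ENNReal.coe_mul, ENNReal.coe_toNNReal hS',
          mul_right_comm, mul_assoc]

end PointProcess

end Marking

lemma integral_measureReal_prodMk_left {α β : Type*} [MeasurableSpace α] [MeasurableSpace β]
    {m : Measure α} {ν : Measure β} [SFinite ν] {S : Set (α × β)} (hS : MeasurableSet S)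
    (hS' : m.prod ν S ≠ ∞) : ∫ x, ν.real (Prod.mk x ⁻¹' S) ∂m = (m.prod ν).real S := by
  rw [measureReal_def, Measure.prod_apply hS]
  exact integral_toReal (measurable_measure_prodMk_left hS).aemeasurable
    (Measure.ae_measure_lt_top hS hS')

section Particles

/-- The pairs of a starting point and a displacement path for which the displaced point lies in `B`
at all the times `t k`. -/
def stayingSet {E T ι : Type*} [Add E] (B : Set E) (t : ι → T) : Set (E × (T → E)) :=
  {z | ∀ k, z.1 + z.2 (t k) ∈ B}

lemma measurableSet_stayingSet {E T ι : Type*} [Add E] [MeasurableSpace E] [MeasurableAdd₂ E]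
    [Countable ι] {B : Set E} (hB : MeasurableSet B) (t : ι → T) :
    MeasurableSet (stayingSet B t) := by
  rw [stayingSet, Set.ofPred_forall]
  exact .iInter fun k => hB.preimage
    (measurable_fst.add ((measurable_pi_apply (t k)).comp measurable_snd))

/-- For a fixed displacement path and a single time, the starting points in question form a
translate of `B`. -/
lemma prod_stayingSet_le {E T ι : Type*} [AddGroup E] [MeasurableSpace E] [MeasurableAdd₂ E]
    [Countable ι] [Nonempty ι] (m : Measure E) [SFinite m] [m.IsAddRightInvariant]
    (ν : Measure (T → E)) [IsProbabilityMeasure ν] {B : Set E} (hB : MeasurableSet B)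
    (t : ι → T) : m.prod ν (stayingSet B t) ≤ m B := by
  obtain ⟨k⟩ := ‹Nonempty ι›
  calc m.prod ν (stayingSet B t)
      = ∫⁻ y, m {x | ∀ k, x + y (t k) ∈ B} ∂ν :=
        Measure.prod_apply_symm (measurableSet_stayingSet hB t)
    _ ≤ ∫⁻ y, m {x | x + y (t k) ∈ B} ∂ν :=
        lintegral_mono fun y => measure_mono fun x hx => hx k
    _ = ∫⁻ _, m B ∂ν := lintegral_congr fun y => measure_preimage_add_right m (y (t k)) B
    _ = m B := by simp

lemma jointCount_eq_tsum_indicator {Ω : Type*} {d : ℕ} (ξ : ℤ → Ω → EuclideanSpace ℝ (Fin d))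
    (Z : ℤ → ℝ≥0 → Ω → EuclideanSpace ℝ (Fin d)) (B : Set (EuclideanSpace ℝ (Fin d)))
    {n : ℕ} (t : Fin n → ℝ≥0) :
    jointCount ξ Z B t
      = fun ω => ∑' j, (stayingSet B t).indicator 1 (ξ j ω, fun s => Z j s ω) := by
  classical
  funext ω
  refine tsum_congr fun j => ?_
  rw [Set.indicator_apply]
  congr

lemma IsParticleModel.isIndependentMarking {Ω Ω' : Type*} [MeasurableSpace Ω] [MeasurableSpace Ω']
    {d : ℕ} {μ : Measure Ω} {P : Measure Ω'} {lam : ℝ≥0} {ξ : ℤ → Ω → EuclideanSpace ℝ (Fin d)}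
    {Z : ℤ → ℝ≥0 → Ω → EuclideanSpace ℝ (Fin d)} {Y : ℝ≥0 → Ω' → EuclideanSpace ℝ (Fin d)}
    (h : IsParticleModel ξ Z μ Y P lam) :
    IsIndependentMarking ξ (fun j ω s => Z j s ω) (P.map fun ω' s => Y s ω') μ where
  measurable_point := h.measurable_position
  measurable_mark j := measurable_pi_lambda _ (h.measurable_displacement j)
  map_mark j := (h.copies j).map_eq
  iIndepFun_mark := h.indep_displacements
  indepFun := h.indep

end Particles

theorem mainTheorem9_general {Ω Ω' : Type*} [MeasurableSpace Ω] [MeasurableSpace Ω'] (d : ℕ)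
    (μ : Measure Ω) (P : Measure Ω') [IsProbabilityMeasure P] (lam : ℝ≥0)
    (ξ : ℤ → Ω → EuclideanSpace ℝ (Fin d)) (Z : ℤ → ℝ≥0 → Ω → EuclideanSpace ℝ (Fin d))
    (Y : ℝ≥0 → Ω' → EuclideanSpace ℝ (Fin d))
    (hmodel : IsParticleModel ξ Z μ Y P lam)
    (B : Set (EuclideanSpace ℝ (Fin d))) (hB : MeasurableSet B) (hB' : volume B ≠ ∞)
    (n : ℕ) (hn : 1 ≤ n) (t : Fin n → ℝ≥0) :
    Integrable (fun x : EuclideanSpace ℝ (Fin d) =>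
        P.real {ω' | ∀ k, x + Y (t k) ω' ∈ B}) volume ∧
    (∀ᵐ ω ∂μ, jointCount ξ Z B t ω ≠ ∞) ∧
    HasLaw (jointCount ξ Z B t) (poissonLaw (lam *
      (∫ x : EuclideanSpace ℝ (Fin d), P.real {ω' | ∀ k, x + Y (t k) ω' ∈ B}).toNNReal)) μ ∧
    ∀ θ : ℝ,
      Integrable (fun ω => Real.exp (θ * (jointCount ξ Z B t ω).toReal)) μ ∧
      Real.log (∫ ω, Real.exp (θ * (jointCount ξ Z B t ω).toReal) ∂μ) =
        lam * (Real.exp θ - 1) *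
          ∫ x : EuclideanSpace ℝ (Fin d), P.real {ω' | ∀ k, x + Y (t k) ω' ∈ B} := by
  set ν := P.map fun ω' s => Y s ω'
  have hY : Measurable fun ω' s => Y s ω' := measurable_pi_lambda _ hmodel.displacement.measurable
  have : IsProbabilityMeasure ν := Measure.isProbabilityMeasure_map hY.aemeasurable
  have : Nonempty (Fin n) := ⟨⟨0, hn⟩⟩
  have hS := measurableSet_stayingSet hB t
  have hS' : volume.prod ν (stayingSet B t) ≠ ∞ :=
    ((prod_stayingSet_le volume ν hB t).trans_lt hB'.lt_top).ne
  have hslice (x) :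
      P.real {ω' | ∀ k, x + Y (t k) ω' ∈ B} = ν.real (Prod.mk x ⁻¹' stayingSet B t) :=
    (map_measureReal_apply hY (measurable_prodMk_left hS)).symm
  have hlaw := hmodel.poisson.hasLaw_tsum_indicator_marked hmodel.isIndependentMarking hS hS'
  rw [← jointCount_eq_tsum_indicator] at hlaw
  simp only [hslice, integral_measureReal_prodMk_left hS hS']
  refine ⟨Measure.integrable_measure_prodMk_left hS hS', ae_ne_top_of_hasLaw_poissonLaw hlaw,
    ?_, fun θ => ⟨integrable_exp_mul_of_hasLaw_poissonLaw hlaw θ, ?_⟩⟩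
  · simpa [measureReal_def] using hlaw
  · refine (cgf_toReal_of_hasLaw_poissonLaw hlaw θ).trans ?_
    rw [NNReal.coe_mul, mul_right_comm]
    rfl

theorem mainTheorem9 {Ω Ω' : Type*} [MeasurableSpace Ω] [MeasurableSpace Ω'] (d : ℕ)
    (μ : Measure Ω) [IsProbabilityMeasure μ] (P : Measure Ω') [IsProbabilityMeasure P]
    (lam : ℝ≥0) (hlam : 0 < lam)
    (ξ : ℤ → Ω → EuclideanSpace ℝ (Fin d)) (Z : ℤ → ℝ≥0 → Ω → EuclideanSpace ℝ (Fin d))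
    (Y : ℝ≥0 → Ω' → EuclideanSpace ℝ (Fin d))
    (hmodel : IsParticleModel ξ Z μ Y P lam)
    (B : Set (EuclideanSpace ℝ (Fin d))) (hB : IsCompact B) (hB' : (interior B).Nonempty)
    (n : ℕ) (hn : 1 ≤ n) (t : Fin n → ℝ≥0) :
    Integrable (fun x : EuclideanSpace ℝ (Fin d) =>
        P.real {ω' | ∀ k, x + Y (t k) ω' ∈ B}) volume ∧
    (∀ᵐ ω ∂μ, jointCount ξ Z B t ω ≠ ∞) ∧
    HasLaw (jointCount ξ Z B t)
      (poissonLaw (lam * (∫ x : EuclideanSpace ℝ (Fin d), P.real {ω' | ∀ k, x + Y (t k) ω' ∈ B}).toNNReal)) μ ∧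
    ∀ θ : ℝ,
      Integrable (fun ω => Real.exp (θ * (jointCount ξ Z B t ω).toReal)) μ ∧
      Real.log (∫ ω, Real.exp (θ * (jointCount ξ Z B t ω).toReal) ∂μ) =
        lam * (Real.exp θ - 1) *
          ∫ x : EuclideanSpace ℝ (Fin d), P.real {ω' | ∀ k, x + Y (t k) ω' ∈ B} :=
  mainTheorem9_general d μ P lam ξ Z Y hmodel B hB.measurableSet hB.measure_ne_top n hn t
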